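/- Let $d,n\ge 1$ be integers, let $\mathbb D=\{z\in\mathbb C:|z|<1\}$, and let $\overline{\mathbb D}$ be its closure. Let $A(\mathbb D^d)$ be the polydisc algebra of all continuous functions $f:\overline{\mathbb D}^d\to\mathbb C$ that are holomorphic in $\mathbb D^d$, with pointwise operations, and let $A_{\mathrm{sym}}(\mathbb D^d)$ be the subalgebra of all $f\in A(\mathbb D^d)$ that are symmetric, i.e. $f(z_1,\dots,z_d)=f(z_{\sigma(1)},\dots,z_{\sigma(d)})$ for all $(z_1,\dots,z_d)\in\mathbb D^d$ and all permutations $\sigma$ of $\{1,\dots,d\}$. Let $f_1,\dots,f_n\in A_{\mathrm{sym}}(\mathbb D^d)$. Then the following are equivalent: (1) There exist $g_1,\dots,g_n\in A_{\mathrm{sym}}(\mathbb D^d)$ such that $f_1g_1+\cdots+f_ng_n=\mathbf 1$, where $\mathbf 1$ is the constant function with value $1$. (2) There exists $\delta>0$ such that $|f_1(\mathbf z)|+\cdots+|f_n(\mathbf z)|\ge\delta$ for all $\mathbf z\in\mathbb D^d$. -/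

import Mathlib

/-- The open unit polydisc `𝔻^d` in `ℂ^d`. -/
def openPolydisc (d : ℕ) : Set (Fin d → ℂ) := {z | ∀ i, ‖z i‖ < 1}

/-- The closed unit polydisc in `ℂ^d`, the `d`-fold power of the closed unit disc. -/
def closedPolydisc (d : ℕ) : Set (Fin d → ℂ) := {z | ∀ i, ‖z i‖ ≤ 1}

/-- The action `σ z = (z_{σ(1)}, …, z_{σ(d)})` of a permutation on the closed polydisc. -/
def permPoint {d : ℕ} (σ : Equiv.Perm (Fin d)) (z : closedPolydisc d) : closedPolydisc d :=
  ⟨fun i => z.1 (σ i), fun i => z.2 (σ i)⟩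

/-- `f`, given on the closed polydisc, is holomorphic in the open polydisc. The values outside
the closed polydisc of the extension by zero are irrelevant, since the open polydisc is open. -/
def IsHolomorphicInside {d : ℕ} (f : closedPolydisc d → ℂ) : Prop :=
  DifferentiableOn ℂ (Function.extend Subtype.val f 0) (openPolydisc d)

/-- `f` is symmetric: `f z = f (σ z)` for all `z` in the open polydisc and all permutations. -/
def IsSymmetricInside {d : ℕ} (f : closedPolydisc d → ℂ) : Prop :=
  ∀ z : closedPolydisc d, z.1 ∈ openPolydisc d →
    ∀ σ : Equiv.Perm (Fin d), f z = f (permPoint σ z)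

theorem openPolydisc_subset_closedPolydisc (d : ℕ) : openPolydisc d ⊆ closedPolydisc d :=
  fun _ hz i => (hz i).le

theorem isHolomorphicInside_iff {d : ℕ} (f : closedPolydisc d → ℂ) :
    IsHolomorphicInside f ↔ ∃ F : (Fin d → ℂ) → ℂ, DifferentiableOn ℂ F (openPolydisc d) ∧
      ∀ z : closedPolydisc d, z.1 ∈ openPolydisc d → F z.1 = f z := by
  constructor
  · intro h
    exact ⟨_, h, fun z _ => Subtype.val_injective.extend_apply f 0 z⟩
  · rintro ⟨F, hF, hFf⟩
    refine hF.congr fun z hz => ?_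
    have h := hFf ⟨z, openPolydisc_subset_closedPolydisc d hz⟩ hz
    have h' := Subtype.val_injective.extend_apply f 0
      (⟨z, openPolydisc_subset_closedPolydisc d hz⟩ : closedPolydisc d)
    exact h'.trans h.symm

/-- The polydisc algebra `A(𝔻^d)`: continuous functions on the closed polydisc that are
holomorphic in the open polydisc, with the pointwise operations. -/
def polydiscAlgebra (d : ℕ) : Subalgebra ℂ C(closedPolydisc d, ℂ) where
  carrier := {f | IsHolomorphicInside f}
  mul_mem' := by
    intro f g hf hg
    obtain ⟨F, hF, hFf⟩ := (isHolomorphicInside_iff _).1 hf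
    obtain ⟨G, hG, hGg⟩ := (isHolomorphicInside_iff _).1 hg
    exact (isHolomorphicInside_iff _).2
      ⟨fun z => F z * G z, hF.mul hG, fun z hz => by simp [hFf z hz, hGg z hz]⟩
  add_mem' := by
    intro f g hf hg
    obtain ⟨F, hF, hFf⟩ := (isHolomorphicInside_iff _).1 hf
    obtain ⟨G, hG, hGg⟩ := (isHolomorphicInside_iff _).1 hg
    exact (isHolomorphicInside_iff _).2
      ⟨fun z => F z + G z, hF.add hG, fun z hz => by simp [hFf z hz, hGg z hz]⟩
  algebraMap_mem' := by
    intro c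
    exact (isHolomorphicInside_iff _).2
      ⟨fun _ => c, differentiableOn_const c, fun z _ => by simp⟩

/-- The algebra `A_sym(𝔻^d)` of the symmetric functions in the polydisc algebra. -/
def symPolydiscAlgebra (d : ℕ) : Subalgebra ℂ C(closedPolydisc d, ℂ) where
  carrier := {f | f ∈ polydiscAlgebra d ∧ IsSymmetricInside f}
  mul_mem' := by
    intro f g hf hg
    refine ⟨mul_mem hf.1 hg.1, fun z hz σ => ?_⟩
    simp only [ContinuousMap.mul_apply, ← hf.2 z hz σ, ← hg.2 z hz σ]
  add_mem' := by
    intro f g hf hg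
    refine ⟨add_mem hf.1 hg.1, fun z hz σ => ?_⟩
    simp only [ContinuousMap.add_apply, ← hf.2 z hz σ, ← hg.2 z hz σ]
  algebraMap_mem' := by
    intro c
    exact ⟨Subalgebra.algebraMap_mem _ c, fun z _ σ => by simp⟩

/-! (2) ⇒ (1) is Gelfand theory followed by averaging. The uniform closure of the polynomials is a
commutative Banach algebra generated by the coordinates, so a character is fixed by its values on
them; these have modulus at most 1, hence every character is evaluation at a point of the closed
polydisc. By continuity the lower bound holds there too, so the `f i` lie in no common maximal ideal
and a Bezout identity exists (`exists_bezout_polydiscAlgebra`). Averaging its coefficients over all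
permutations keeps the identity, since the `f i` are invariant. The converse is a sup-norm estimate.
-/

instance closedPolydisc.instCompactSpace (d : ℕ) : CompactSpace (closedPolydisc d) := by
  rw [← isCompact_iff_compactSpace]
  have h : closedPolydisc d = Set.univ.pi fun _ => Metric.closedBall (0 : ℂ) 1 := by
    ext z
    simp [closedPolydisc]
  rw [h]
  exact isCompact_univ_pi fun _ => isCompact_closedBall 0 1

instance closedPolydisc.instNonempty (d : ℕ) : Nonempty (closedPolydisc d) :=
  ⟨⟨0, fun i => by simp⟩⟩

theorem continuous_closedPolydisc_apply {d : ℕ} (i : Fin d) :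
    Continuous fun z : closedPolydisc d => z.1 i :=
  (continuous_apply i).comp continuous_subtype_val

/-- The `i`-th coordinate function on the closed polydisc. -/
def polydiscCoord {d : ℕ} (i : Fin d) : C(closedPolydisc d, ℂ) :=
  ⟨fun z => z.1 i, continuous_closedPolydisc_apply i⟩

/-- The algebra of polynomial functions on the closed polydisc. -/
noncomputable def polydiscPolynomials (d : ℕ) : Subalgebra ℂ C(closedPolydisc d, ℂ) :=
  Algebra.adjoin ℂ (Set.range polydiscCoord)

/-- The uniform closure of the polynomial functions on the closed polydisc. -/
noncomputable abbrev polydiscUniformAlgebra (d : ℕ) : Subalgebra ℂ C(closedPolydisc d, ℂ) :=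
  (polydiscPolynomials d).topologicalClosure

theorem isClosed_polydiscUniformAlgebra (d : ℕ) :
    IsClosed (polydiscUniformAlgebra d : Set C(closedPolydisc d, ℂ)) :=
  Subalgebra.isClosed_topologicalClosure _

instance polydiscUniformAlgebra.instCompleteSpace (d : ℕ) :
    CompleteSpace (polydiscUniformAlgebra d) :=
  (isClosed_polydiscUniformAlgebra d).completeSpace_coe

theorem polydiscCoord_mem {d : ℕ} (i : Fin d) : polydiscCoord i ∈ polydiscUniformAlgebra d :=
  Subalgebra.le_topologicalClosure _ (Algebra.subset_adjoin ⟨i, rfl⟩)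

theorem norm_polydiscCoord_le {d : ℕ} (i : Fin d) : ‖(polydiscCoord i)‖ ≤ 1 :=
  (ContinuousMap.norm_le _ zero_le_one).2 fun z => z.2 i

/-! ### Polynomial approximation -/

theorem exists_resolvent_mem {d : ℕ} (j : Fin d) {ζ : ℂ} (hζ : 1 < ‖ζ‖) :
    ∃ b ∈ polydiscUniformAlgebra d, ∀ z, b z = (ζ - z.1 j)⁻¹ := by
  have h1 : ‖(1 : polydiscUniformAlgebra d)‖ = 1 := by
    change ‖(1 : C(closedPolydisc d, ℂ))‖ = 1
    exact norm_one
  -- The resolvent is taken in the closed subalgebra, so the Cauchy kernel is itself a uniform limit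
  -- of polynomials.
  have h : ζ ∈ resolventSet ℂ (⟨polydiscCoord j, polydiscCoord_mem j⟩ : polydiscUniformAlgebra d) := by
    apply spectrum.mem_resolventSet_of_norm_lt_mul
    rw [h1, mul_one]
    exact (norm_polydiscCoord_le j).trans_lt hζ
  obtain ⟨u, hu⟩ := h
  refine ⟨(u⁻¹ : (polydiscUniformAlgebra d)ˣ).1.1, (u⁻¹ : (polydiscUniformAlgebra d)ˣ).1.2,
    fun z => eq_inv_of_mul_eq_one_left ?_⟩
  have h2 := congrArg (fun a : polydiscUniformAlgebra d => a.1 z) u.inv_mul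
  rw [hu] at h2
  simpa [polydiscCoord] using h2

/-- Cauchy's formula in one variable, applied under the constraint that only the variables in `s`
are free, shows that a function holomorphic near the closed polydisc is a uniform limit of
polynomials. -/
theorem exists_mem_piecewise_of_differentiableOn {d : ℕ} {F : (Fin d → ℂ) → ℂ} {R : ℝ}
    (hR : 1 < R) (hF : DifferentiableOn ℂ F {z | ∀ i, ‖z i‖ < R}) (s : Finset (Fin d)) :
    ∀ w : Fin d → ℂ, (∀ i, ‖w i‖ < R) →
      ∃ b ∈ polydiscUniformAlgebra d, ∀ z, b z = F (s.piecewise z.1 w) := by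
  classical
  induction s using Finset.induction_on with
  | empty =>
    intro w _
    exact ⟨algebraMap ℂ _ (F w), Subalgebra.algebraMap_mem _ _, fun z => by simp⟩
  | insert j s hj ih =>
    intro w hw
    -- A circle of radius `ρ` lies in the domain of `F` and stays off the closed unit disc, so the
    -- kernel has no pole.
    obtain ⟨ρ, hρ1, hρR⟩ := exists_between hR
    have hρ0 : 0 < ρ := one_pos.trans hρ1
    have hmem : ∀ (z : closedPolydisc d) (ζ : ℂ), ‖ζ‖ < R →
        Function.update (s.piecewise z.1 w) j ζ ∈ {z : Fin d → ℂ | ∀ i, ‖z i‖ < R} := by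
      intro z ζ hζ i
      by_cases hij : i = j
      · subst hij
        simpa using hζ
      · rw [Function.update_of_ne hij]
        by_cases his : i ∈ s
        · simpa [his] using (z.2 i).trans_lt hR
        · simpa [his] using hw i
    have hnorm : ∀ θ : ℝ, ‖circleMap 0 ρ θ‖ = ρ := fun θ => by simp [abs_of_pos hρ0]
    have hne : ∀ (θ : ℝ) (z : closedPolydisc d), circleMap 0 ρ θ - z.1 j ≠ 0 := by
      intro θ z h
      have h1 := hnorm θ
      rw [sub_eq_zero.1 h] at h1
      exact absurd (z.2 j) (not_le.2 (h1 ▸ hρ1))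
    have hpw : Continuous fun p : ℝ × closedPolydisc d =>
        Function.update (s.piecewise p.2.1 w) j (circleMap 0 ρ p.1) := by
      refine Continuous.update (continuous_pi fun i => ?_) j
        ((continuous_circleMap 0 ρ).comp continuous_fst)
      by_cases his : i ∈ s
      · simp only [Finset.piecewise, his, if_true]
        exact (continuous_closedPolydisc_apply i).comp continuous_snd
      · simp only [Finset.piecewise, his, if_false]
        fun_prop
    have hcirc : Continuous fun p : ℝ × closedPolydisc d => circleMap 0 ρ p.1 :=
      (continuous_circleMap 0 ρ).comp continuous_fst
    let H : C(ℝ × closedPolydisc d, ℂ) :=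
      ⟨fun p => deriv (circleMap 0 ρ) p.1 • ((circleMap 0 ρ p.1 - p.2.1 j)⁻¹ •
          F (Function.update (s.piecewise p.2.1 w) j (circleMap 0 ρ p.1))), by
        simp only [deriv_circleMap]
        simp only [smul_eq_mul]
        refine (hcirc.mul continuous_const).mul (Continuous.mul ?_ ?_)
        · exact (hcirc.sub ((continuous_closedPolydisc_apply j).comp continuous_snd)).inv₀ fun p => hne p.1 p.2
        · exact hF.continuousOn.comp_continuous hpw fun p => hmem _ _ (by rw [hnorm]; exact hρR)⟩
    -- For fixed `θ` the variable `j` is frozen on the circle, so the induction hypothesis applies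
    -- to the factor `F`.
    have hHmem : ∀ θ, H.curry θ ∈ polydiscUniformAlgebra d := by
      intro θ
      obtain ⟨b, hb, hbz⟩ := ih (Function.update w j (circleMap 0 ρ θ)) fun i => by
        by_cases hij : i = j
        · subst hij
          rw [Function.update_self, hnorm]
          exact hρR
        · rw [Function.update_of_ne hij]
          exact hw i
      obtain ⟨c, hc, hcz⟩ := exists_resolvent_mem (d := d) j (ζ := circleMap 0 ρ θ)
        (by rw [hnorm]; exact hρ1)
      have h : H.curry θ = deriv (circleMap 0 ρ) θ • (c * b) := by
        ext z
        simp [H, hbz, hcz, Finset.update_piecewise_of_notMem _ _ _ hj]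
      rw [h]
      exact Subalgebra.smul_mem _ (mul_mem hc hb) _
    let h : ℝ → polydiscUniformAlgebra d := fun θ => ⟨H.curry θ, hHmem θ⟩
    -- Currying gives continuity in sup norm, so the Cauchy integral can be formed inside the
    -- complete subalgebra.
    have hcont : Continuous h := H.curry.continuous.subtype_mk _
    let I : polydiscUniformAlgebra d := (2 * Real.pi * Complex.I : ℂ)⁻¹ •
      ∫ θ in (0 : ℝ)..2 * Real.pi, h θ
    refine ⟨I.1, I.2, fun z => ?_⟩
    let ev : polydiscUniformAlgebra d →L[ℂ] ℂ :=
      (ContinuousMap.evalCLM ℂ z).comp (polydiscUniformAlgebra d).toSubmodule.subtypeL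
    have hev : ev (∫ θ in (0 : ℝ)..2 * Real.pi, h θ) = ∫ θ in (0 : ℝ)..2 * Real.pi, ev (h θ) :=
      (ev.intervalIntegral_comp_comm (hcont.intervalIntegrable _ _)).symm
    have hI : I.1 z = (2 * Real.pi * Complex.I : ℂ)⁻¹ •
        ∫ θ in (0 : ℝ)..2 * Real.pi, ev (h θ) := by
      rw [← hev, ← map_smul]
      rfl
    have hdiff : DifferentiableOn ℂ (fun ζ => F (Function.update (s.piecewise z.1 w) j ζ))
        (Metric.ball 0 R) := by
      refine hF.comp ?_ fun ζ hζ => hmem z ζ (by simpa using hζ)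
      exact fun ζ _ => (hasDerivAt_update _ j ζ).differentiableAt.differentiableWithinAt
    rw [hI, Finset.piecewise_insert]
    refine Complex.two_pi_I_inv_smul_circleIntegral_sub_inv_smul_of_differentiable_on_off_countable
      Set.countable_empty (w := z.1 j) (c := 0) (R := ρ)
      (f := fun ζ => F (Function.update (s.piecewise z.1 w) j ζ)) ?_ ?_ ?_
    · simpa using (z.2 j).trans_lt hρ1
    · exact hdiff.continuousOn.mono (Metric.closedBall_subset_ball hρR)
    · intro x hx
      exact hdiff.differentiableAt (Metric.isOpen_ball.mem_nhds
        (Metric.ball_subset_ball hρR.le hx.1))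

theorem exists_mem_of_differentiableOn {d : ℕ} {F : (Fin d → ℂ) → ℂ} {R : ℝ}
    (hR : 1 < R) (hF : DifferentiableOn ℂ F {z | ∀ i, ‖z i‖ < R}) :
    ∃ b ∈ polydiscUniformAlgebra d, ∀ z, b z = F z.1 := by
  simpa using exists_mem_piecewise_of_differentiableOn hR hF Finset.univ 0
    fun i => by simpa using one_pos.trans hR

/-- The dilation `z ↦ r z`, with `r` clamped to `[0, 1]`. -/
def polydiscDilation {d : ℕ} (r : ℝ) (z : closedPolydisc d) : closedPolydisc d :=
  ⟨fun i => ((max 0 (min r 1) : ℝ) : ℂ) * z.1 i, fun i => by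
    rw [norm_mul, Complex.norm_real, Real.norm_of_nonneg (le_max_left _ _)]
    exact mul_le_one₀ (max_le zero_le_one (min_le_right _ _)) (norm_nonneg _) (z.2 i)⟩

theorem continuous_polydiscDilation (d : ℕ) :
    Continuous fun p : ℝ × closedPolydisc d => polydiscDilation p.1 p.2 := by
  refine Continuous.subtype_mk (continuous_pi fun i => Continuous.mul (by fun_prop) ?_) _
  exact (continuous_closedPolydisc_apply i).comp continuous_snd

theorem polydiscDilation_one {d : ℕ} (z : closedPolydisc d) : polydiscDilation 1 z = z := by
  ext i
  simp [polydiscDilation]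

theorem polydiscDilation_mem_openPolydisc {d : ℕ} {r : ℝ} (hr : r < 1) (z : closedPolydisc d) :
    (polydiscDilation r z).1 ∈ openPolydisc d := fun i => by
  have h : max 0 (min r 1) < 1 := max_lt one_pos (min_lt_of_left_lt hr)
  change ‖((max 0 (min r 1) : ℝ) : ℂ) * z.1 i‖ < 1
  rw [norm_mul, Complex.norm_real, Real.norm_of_nonneg (le_max_left _ _)]
  exact mul_lt_one_of_nonneg_of_lt_one_left (le_max_left _ _) h (z.2 i)

/-- A closed condition that holds on the open polydisc holds on the closed polydisc. -/
theorem forall_closedPolydisc_of_isClosed {d : ℕ} {S : Set (closedPolydisc d)} (hS : IsClosed S)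
    (h : ∀ z : closedPolydisc d, z.1 ∈ openPolydisc d → z ∈ S) (z : closedPolydisc d) : z ∈ S := by
  have hc : Continuous fun r : ℝ => polydiscDilation r z :=
    (continuous_polydiscDilation d).comp (by fun_prop : Continuous fun r : ℝ => (r, z))
  have h1 : (1 : ℝ) ∈ closure (Set.Iio (1 : ℝ)) := by simp
  have h2 := map_mem_closure hc h1 (t := S) fun r hr => h _ (polydiscDilation_mem_openPolydisc hr z)
  rwa [hS.closure_eq, polydiscDilation_one] at h2

/-- For `0 < r < 1` the dilate `z ↦ f (r z)` is holomorphic on the polydisc of radius `r⁻¹ > 1`, and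
the dilates tend uniformly to `f` as `r → 1`. -/
theorem polydiscAlgebra_le_polydiscUniformAlgebra (d : ℕ) :
    polydiscAlgebra d ≤ polydiscUniformAlgebra d := by
  intro f hf
  obtain ⟨F, hF, hFf⟩ := (isHolomorphicInside_iff _).1 hf
  let Φ : C(ℝ × closedPolydisc d, ℂ) :=
    ⟨fun p => f (polydiscDilation p.1 p.2), f.continuous.comp (continuous_polydiscDilation d)⟩
  have h1 : (1 : ℝ) ∈ closure (Set.Ioo (0 : ℝ) 1) := by simp [closure_Ioo]
  have h2 := map_mem_closure Φ.curry.continuous h1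
    (t := (polydiscUniformAlgebra d : Set C(closedPolydisc d, ℂ))) ?_
  · rw [(isClosed_polydiscUniformAlgebra d).closure_eq] at h2
    have h3 : Φ.curry 1 = f := by
      ext z
      simp [Φ, polydiscDilation_one]
    rwa [h3] at h2
  · rintro r ⟨hr0, hr1⟩
    obtain ⟨b, hb, hbz⟩ := exists_mem_of_differentiableOn (d := d) (F := fun z => F fun i => r * z i)
      (R := r⁻¹) ((one_lt_inv₀ hr0).2 hr1) (by
        refine hF.comp (by fun_prop) fun z hz i => ?_
        rw [norm_mul, Complex.norm_real, Real.norm_of_nonneg hr0.le]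
        calc r * ‖z i‖ < r * r⁻¹ := by gcongr; exact hz i
          _ = 1 := mul_inv_cancel₀ hr0.ne')
    have h4 : Φ.curry r = b := by
      ext z
      rw [hbz]
      have h5 := hFf (polydiscDilation r z) (polydiscDilation_mem_openPolydisc hr1 z)
      simpa [Φ, polydiscDilation, hr1.le, hr0.le] using h5.symm
    rw [h4]
    exact hb

/-- Every character of the uniform closure of the polynomials is a point evaluation. -/
theorem exists_eval_of_character {d : ℕ}
    (φ : WeakDual.characterSpace ℂ (polydiscUniformAlgebra d)) :
    ∃ z : closedPolydisc d, ∀ b : polydiscUniformAlgebra d, φ b = b.1 z := by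
  have h1 : ‖(1 : polydiscUniformAlgebra d)‖ = 1 := by
    change ‖(1 : C(closedPolydisc d, ℂ))‖ = 1
    exact norm_one
  let X : Fin d → polydiscUniformAlgebra d := fun i => ⟨polydiscCoord i, polydiscCoord_mem i⟩
  let z : closedPolydisc d := ⟨fun i => φ (X i), fun i => by
    have h := spectrum.norm_le_norm_mul_of_mem (AlgHom.apply_mem_spectrum φ (X i))
    rw [h1, mul_one] at h
    exact h.trans (norm_polydiscCoord_le i)⟩
  refine ⟨z, fun b => ?_⟩
  have hcl : IsClosed {b : polydiscUniformAlgebra d | φ b = b.1 z} :=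
    isClosed_eq (map_continuous φ) (by fun_prop)
  have hpoly : ∀ (p : C(closedPolydisc d, ℂ)) (hp : p ∈ polydiscPolynomials d),
      φ ⟨p, Subalgebra.le_topologicalClosure _ hp⟩ = p z := by
    intro p hp
    induction hp using Algebra.adjoin_induction with
    | mem x hx =>
      obtain ⟨i, rfl⟩ := hx
      rfl
    | algebraMap r => exact AlgHomClass.commutes φ r
    | add x y hx hy ihx ihy =>
      rw [ContinuousMap.add_apply, ← ihx, ← ihy, ← map_add]
      rfl
    | mul x y hx hy ihx ihy =>
      rw [ContinuousMap.mul_apply, ← ihx, ← ihy, ← map_mul]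
      rfl
  have hb : b ∈ closure {b : polydiscUniformAlgebra d | b.1 ∈ polydiscPolynomials d} := by
    rw [closure_subtype]
    refine closure_mono ?_ b.2
    exact fun p hp => ⟨⟨p, Subalgebra.le_topologicalClosure _ hp⟩, hp, rfl⟩
  exact closure_minimal (fun b hb => hpoly b.1 hb) hcl hb

/-- Otherwise some maximal ideal contains all `f i`; by Gelfand–Mazur it is the kernel of a
character, that is, of a point evaluation, giving a common zero. -/
theorem exists_bezout_polydiscUniformAlgebra {d n : ℕ} (f : Fin n → polydiscUniformAlgebra d)
    (hf : ∀ z, ∃ i, (f i).1 z ≠ 0) :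
    ∃ g : Fin n → polydiscUniformAlgebra d, ∑ i, g i * f i = 1 := by
  by_contra hg
  have hI : Ideal.span (Set.range f) ≠ ⊤ := by
    rw [Ne, Ideal.eq_top_iff_one, Ideal.mem_span_range_iff_exists_fun]
    exact hg
  obtain ⟨M, hM, hle⟩ := Ideal.exists_le_maximal _ hI
  obtain ⟨z, hz⟩ := exists_eval_of_character M.toCharacterSpace
  obtain ⟨i, hi⟩ := hf z
  exact hi ((hz (f i)).symm.trans
    (M.toCharacterSpace_apply_eq_zero_of_mem (hle (Ideal.subset_span ⟨i, rfl⟩))))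

theorem polydiscPolynomials_le_polydiscAlgebra (d : ℕ) :
    polydiscPolynomials d ≤ polydiscAlgebra d := by
  refine Algebra.adjoin_le ?_
  rintro _ ⟨i, rfl⟩
  exact (isHolomorphicInside_iff _).2 ⟨fun z => z i, by fun_prop, fun z _ => rfl⟩

theorem exists_inv_mem_polydiscAlgebra {d : ℕ} {u : C(closedPolydisc d, ℂ)}
    (hu : u ∈ polydiscAlgebra d) (h0 : ∀ z, u z ≠ 0) :
    ∃ v ∈ polydiscAlgebra d, u * v = 1 := by
  obtain ⟨F, hF, hFu⟩ := (isHolomorphicInside_iff _).1 hu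
  refine ⟨⟨fun z => (u z)⁻¹, u.continuous.inv₀ h0⟩, (isHolomorphicInside_iff _).2
    ⟨fun z => (F z)⁻¹, hF.inv fun z hz => ?_, fun z hz => ?_⟩, ?_⟩
  · have h := hFu ⟨z, openPolydisc_subset_closedPolydisc d hz⟩ hz
    exact fun hz0 => h0 _ (h.symm.trans hz0)
  · simp [hFu z hz]
  · ext z
    simp [h0 z]

/-- Functions of the polydisc algebra without common zeros generate the unit ideal. -/
theorem exists_bezout_polydiscAlgebra {d n : ℕ} (f : Fin n → C(closedPolydisc d, ℂ))
    (hf : ∀ i, f i ∈ polydiscAlgebra d) (h0 : ∀ z, ∃ i, f i z ≠ 0) :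
    ∃ g : Fin n → C(closedPolydisc d, ℂ),
      (∀ i, g i ∈ polydiscAlgebra d) ∧ ∑ i, f i * g i = 1 := by
  obtain ⟨g, hg⟩ := exists_bezout_polydiscUniformAlgebra
    (fun i => ⟨f i, polydiscAlgebra_le_polydiscUniformAlgebra d (hf i)⟩) h0
  have hg' : ∑ i, f i * (g i).1 = 1 := by
    have h := congrArg Subtype.val hg
    simpa [mul_comm] using h
  -- Holomorphy of the uniform limits `g i` is not needed: polynomials `p i` close to them make `∑
  -- i, f i * p i` lie within 1 of the constant 1, hence zero-free, and one divides by it.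
  have hmem : (fun i => (g i).1) ∈ closure (Set.univ.pi fun _ : Fin n =>
      (polydiscPolynomials d : Set C(closedPolydisc d, ℂ))) := by
    rw [closure_pi_set]
    exact fun i _ => (g i).2
  have hopen : IsOpen {p : Fin n → C(closedPolydisc d, ℂ) | ‖∑ i, f i * p i - 1‖ < 1} :=
    isOpen_lt (by fun_prop) continuous_const
  obtain ⟨p, hp1, hp⟩ := mem_closure_iff.1 hmem _ hopen (by simp [hg'])
  have hpA : ∀ i, p i ∈ polydiscAlgebra d := fun i =>
    polydiscPolynomials_le_polydiscAlgebra d (hp i (Set.mem_univ i))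
  obtain ⟨v, hv, huv⟩ := exists_inv_mem_polydiscAlgebra (u := ∑ i, f i * p i)
    (sum_mem fun i _ => mul_mem (hf i) (hpA i)) (by
      intro z hz
      have h := (ContinuousMap.norm_coe_le_norm (∑ i, f i * p i - 1) z).trans_lt hp1
      rw [ContinuousMap.sub_apply, hz] at h
      simp at h)
  refine ⟨fun i => p i * v, fun i => mul_mem (hpA i) hv, ?_⟩
  simp_rw [← mul_assoc]
  rw [← Finset.sum_mul, huv]

/-- Permuting the coordinates, as a continuous map. -/
def permPointCM {d : ℕ} (σ : Equiv.Perm (Fin d)) : C(closedPolydisc d, closedPolydisc d) :=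
  ⟨permPoint σ, Continuous.subtype_mk
    (continuous_pi fun i => continuous_closedPolydisc_apply (σ i)) _⟩

theorem comp_permPointCM_mem_polydiscAlgebra {d : ℕ} {f : C(closedPolydisc d, ℂ)}
    (hf : f ∈ polydiscAlgebra d) (σ : Equiv.Perm (Fin d)) :
    f.comp (permPointCM σ) ∈ polydiscAlgebra d := by
  obtain ⟨F, hF, hFf⟩ := (isHolomorphicInside_iff _).1 hf
  refine (isHolomorphicInside_iff _).2 ⟨fun z => F fun i => z (σ i), ?_, fun z hz => ?_⟩
  · exact hF.comp (by fun_prop) fun z hz i => hz (σ i)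
  · exact hFf (permPoint σ z) fun i => hz (σ i)

/-! ### Symmetrisation -/

theorem apply_permPoint_of_mem_symPolydiscAlgebra {d : ℕ} {f : C(closedPolydisc d, ℂ)}
    (hf : f ∈ symPolydiscAlgebra d) (σ : Equiv.Perm (Fin d)) (z : closedPolydisc d) :
    f z = f (permPoint σ z) :=
  forall_closedPolydisc_of_isClosed (S := {z | f z = f (permPoint σ z)})
    (isClosed_eq f.continuous (f.continuous.comp (permPointCM σ).continuous))
    (fun z hz => hf.2 z hz σ) z

/-- The average of a function over all permutations of the coordinates. -/
noncomputable def symAverage {d : ℕ} (f : C(closedPolydisc d, ℂ)) : C(closedPolydisc d, ℂ) :=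
  (Fintype.card (Equiv.Perm (Fin d)) : ℂ)⁻¹ • ∑ σ, f.comp (permPointCM σ)

theorem symAverage_apply {d : ℕ} (f : C(closedPolydisc d, ℂ)) (z : closedPolydisc d) :
    symAverage f z = (Fintype.card (Equiv.Perm (Fin d)) : ℂ)⁻¹ * ∑ σ, f (permPoint σ z) := by
  simp only [symAverage, ContinuousMap.smul_apply, ContinuousMap.sum_apply, smul_eq_mul]
  rfl

theorem symAverage_mem {d : ℕ} {f : C(closedPolydisc d, ℂ)} (hf : f ∈ polydiscAlgebra d) :
    symAverage f ∈ symPolydiscAlgebra d := by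
  refine ⟨Subalgebra.smul_mem _ (sum_mem fun σ _ => comp_permPointCM_mem_polydiscAlgebra hf σ) _,
    fun z _ τ => ?_⟩
  rw [symAverage_apply, symAverage_apply]
  congr 1
  -- Permuting by `τ` and then by `σ` is permuting by `τ * σ`, so the sum is only reindexed.
  exact (Fintype.sum_equiv (Equiv.mulLeft τ) _ _ fun σ => rfl).symm

/-- Evaluating the identity at each permuted point leaves the factors `f i` unchanged; then average
over the permutations. -/
theorem sum_mul_symAverage {d n : ℕ} (f g : Fin n → C(closedPolydisc d, ℂ))
    (hf : ∀ i, f i ∈ symPolydiscAlgebra d) (h : ∑ i, f i * g i = 1) :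
    ∑ i, f i * symAverage (g i) = 1 := by
  ext z
  have hσ : ∀ σ : Equiv.Perm (Fin d), ∑ i, f i z * g i (permPoint σ z) = 1 := by
    intro σ
    have h1 := congrArg (fun k : C(closedPolydisc d, ℂ) => k (permPoint σ z)) h
    simpa [← apply_permPoint_of_mem_symPolydiscAlgebra (hf _) σ z] using h1
  have hcard : (Fintype.card (Equiv.Perm (Fin d)) : ℂ) ≠ 0 :=
    Nat.cast_ne_zero.2 Fintype.card_ne_zero
  simp only [ContinuousMap.sum_apply, ContinuousMap.mul_apply, symAverage_apply,
    ContinuousMap.one_apply]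
  simp_rw [mul_left_comm (f _ z), Finset.mul_sum (s := Finset.univ (α := Equiv.Perm (Fin d)))]
  rw [Finset.sum_comm]
  simp_rw [← Finset.mul_sum, hσ]
  simp [hcard]

theorem theorem2p1 (d : ℕ) (hd : 1 ≤ d) (n : ℕ) (hn : 1 ≤ n)
    (f : Fin n → symPolydiscAlgebra d) :
    (∃ g : Fin n → symPolydiscAlgebra d, ∑ i, f i * g i = 1) ↔
      ∃ δ : ℝ, 0 < δ ∧ ∀ z : closedPolydisc d, z.1 ∈ openPolydisc d →
        δ ≤ ∑ i, ‖(f i : C(closedPolydisc d, ℂ)) z‖ := by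
  constructor
  · rintro ⟨g, hg⟩
    -- The summand 1 gives positivity at once; the sum dominates each `‖g i‖`.
    have hM : 0 < 1 + ∑ i, ‖(g i).1‖ := by positivity
    refine ⟨(1 + ∑ i, ‖(g i).1‖)⁻¹, inv_pos.2 hM, fun z _ => ?_⟩
    have h1 : ∑ i, (f i).1 z * (g i).1 z = 1 := by
      simpa using congrArg (fun k : symPolydiscAlgebra d => k.1 z) hg
    rw [inv_le_iff_one_le_mul₀ hM]
    calc (1 : ℝ) = ‖∑ i, (f i).1 z * (g i).1 z‖ := by rw [h1, norm_one]
      _ ≤ ∑ i, ‖(f i).1 z * (g i).1 z‖ := norm_sum_le _ _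
      _ ≤ ∑ i, ‖(f i).1 z‖ * (1 + ∑ i, ‖(g i).1‖) := by
        refine Finset.sum_le_sum fun i _ => ?_
        rw [norm_mul]
        gcongr
        have h2 := ContinuousMap.norm_coe_le_norm (g i).1 z
        have h3 := Finset.single_le_sum (f := fun i => ‖(g i).1‖)
          (fun i _ => norm_nonneg _) (Finset.mem_univ i)
        linarith
      _ = (∑ i, ‖(f i).1 z‖) * (1 + ∑ i, ‖(g i).1‖) := by rw [Finset.sum_mul]
  · rintro ⟨δ, hδ, h⟩
    have hz : ∀ z : closedPolydisc d, δ ≤ ∑ i, ‖(f i).1 z‖ :=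
      forall_closedPolydisc_of_isClosed (S := {z | δ ≤ ∑ i, ‖(f i).1 z‖})
        (isClosed_le continuous_const (by fun_prop)) h
    obtain ⟨g, hgA, hg⟩ := exists_bezout_polydiscAlgebra (fun i => (f i).1)
      (fun i => (f i).2.1) fun z => by
        by_contra! h0
        have h1 := hz z
        simp only [h0, norm_zero, Finset.sum_const_zero] at h1
        exact absurd hδ (not_lt.2 h1)
    refine ⟨fun i => ⟨symAverage (g i), symAverage_mem (hgA i)⟩, Subtype.ext ?_⟩
    have h1 := sum_mul_symAverage (fun i => (f i).1) g (fun i => (f i).2) hg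
    simpa using h1
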